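/- Let $\mathbb N=\{1,2,3,\dots\}$, let $a,b\in\mathbb R$, and let $V:\mathbb N\to\{a,b\}$ be such that, for some $N\in\mathbb N$, the following hold. (S1) For every $n\ge N$ with $n>1$: if $V(n)=b$, then $V(n-1)=V(n+1)=a$. (S2) For every $n\ge N$ and every $k\ge 1$: if $V(n)=V(n+k+1)=b$ and $V(n+j)=a$ for all $1\le j\le k$, then $k$ is odd. Let $H$ be the discrete Schrödinger operator on $\ell^2(\mathbb N)$ with Dirichlet boundary condition, $$(H\psi)(n)=\psi(n-1)+\psi(n+1)+V(n)\psi(n)\quad(n\ge 1),\qquad \psi(0):=0 .$$ For $T>0$ and $p>0$ put $$a(n,T)=\frac1T\int_0^\infty e^{-2t/T}\,\bigl|\langle\delta_n,e^{-itH}\delta_1\rangle\bigr|^2\,dt,\qquad \langle |X|^p_{\delta_1}\rangle(T)=\sum_{n\ge1} n^p\,a(n,T),$$ $$\beta^-_{\delta_1}(p)=\liminf_{T\to+\infty}\frac{\log\,\langle |X|^p_{\delta_1}\rangle(T)}{\log T}.$$ Then, for every $p>0$, $$\beta^-_{\delta_1}(p)\ \ge\ \frac{p-5}{2}.$$ 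-/

import Mathlib

open scoped ENNReal

noncomputable section

namespace HalfLine

/-- The Hilbert space `ℓ²(ℕ)` with `ℕ = {1, 2, 3, …}`. -/
abbrev L2 : Type := lp (fun _ : ℕ+ => ℂ) 2

/-- The unit vector `δ_n`. -/
def delta (n : ℕ+) : L2 := lp.single 2 n (1 : ℂ)

/-- A potential that takes only (at most) two values is bounded. -/
theorem bounded_of_two_values {V : ℕ+ → ℝ} {a b : ℝ} (h : ∀ n, V n = a ∨ V n = b) :
    ∃ C : ℝ, ∀ n, |V n| ≤ C :=
  ⟨max |a| |b|, fun n => by rcases h n with h | h <;> simp [h]⟩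

theorem sum_sq_le (ψ : L2) (s : Finset ℕ+) :
    ∑ i ∈ s, ‖ψ i‖ ^ (2 : ℝ) ≤ ‖ψ‖ ^ (2 : ℝ) := by
  simpa using lp.sum_rpow_le_norm_rpow (p := 2) (by norm_num) ψ s

theorem of_sum_le (f : ℕ+ → ℂ) (C : ℝ) (hC : 0 ≤ C)
    (h : ∀ s : Finset ℕ+, ∑ i ∈ s, ‖f i‖ ^ (2 : ℝ) ≤ C ^ (2 : ℝ)) :
    ∃ g : L2, (∀ n, g n = f n) ∧ ‖g‖ ≤ C :=
  ⟨⟨f, memℓp_gen' (C := C ^ (2 : ℝ)) (by simpa using h)⟩, fun _ => rfl,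
    lp.norm_le_of_forall_sum_le (by norm_num) hC (by simpa using h)⟩

theorem exists_forward (ψ : L2) : ∃ g : L2, (∀ n, g n = ψ (n + 1)) ∧ ‖g‖ ≤ ‖ψ‖ :=
  of_sum_le _ _ (norm_nonneg _) fun s => by
    have h := sum_sq_le ψ (s.map ⟨fun n => n + 1, fun _ _ h => add_right_cancel h⟩)
    rwa [Finset.sum_map] at h

theorem exists_backward (ψ : L2) :
    ∃ g : L2, (∀ n, g n = if n = 1 then 0 else ψ (n - 1)) ∧ ‖g‖ ≤ ‖ψ‖ :=
  of_sum_le _ _ (norm_nonneg _) fun s => by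
    have hinj : Set.InjOn (fun n : ℕ+ => n - 1) (s.filter (· ≠ 1) : Finset ℕ+) := by
      intro x hx y hy h
      simp only [Finset.coe_filter, Set.mem_ofPred_eq] at hx hy
      have hx' := PNat.sub_add_of_lt (lt_of_le_of_ne one_le (Ne.symm hx.2))
      have hy' := PNat.sub_add_of_lt (lt_of_le_of_ne one_le (Ne.symm hy.2))
      simp only at h
      rw [← hx', ← hy', h]
    have h := sum_sq_le ψ ((s.filter (· ≠ 1)).image fun n => n - 1)
    rw [Finset.sum_image hinj, Finset.sum_filter] at h
    refine le_trans (Finset.sum_le_sum fun i _ => ?_) h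
    by_cases hi : i = 1 <;> simp [hi]

theorem exists_mul {V : ℕ+ → ℝ} {C : ℝ} (hC : ∀ n, |V n| ≤ C) (ψ : L2) :
    ∃ g : L2, (∀ n, g n = (V n : ℂ) * ψ n) ∧ ‖g‖ ≤ C * ‖ψ‖ := by
  have hC0 : 0 ≤ C := (abs_nonneg _).trans (hC 1)
  refine of_sum_le _ _ (by positivity) fun s => ?_
  rw [Real.mul_rpow hC0 (norm_nonneg _)]
  refine le_trans ?_ (mul_le_mul_of_nonneg_left (sum_sq_le ψ s) (by positivity))
  rw [Finset.mul_sum]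
  refine Finset.sum_le_sum fun i _ => ?_
  rw [norm_mul, Complex.norm_real, Real.mul_rpow (norm_nonneg _) (norm_nonneg _)]
  gcongr
  exact hC i

/-- `(Hψ)(n) = ψ(n-1) + ψ(n+1) + V(n) ψ(n)`, with the Dirichlet boundary condition `ψ(0) = 0`. -/
def schrodingerFun (V : ℕ+ → ℝ) (ψ : ℕ+ → ℂ) (n : ℕ+) : ℂ :=
  (if n = 1 then 0 else ψ (n - 1)) + ψ (n + 1) + (V n : ℂ) * ψ n

theorem exists_schrodinger {V : ℕ+ → ℝ} {C : ℝ} (hC : ∀ n, |V n| ≤ C) (ψ : L2) :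
    ∃ g : L2, (∀ n, g n = schrodingerFun V ψ n) ∧ ‖g‖ ≤ (2 + C) * ‖ψ‖ := by
  obtain ⟨f, hf, hf'⟩ := exists_forward ψ
  obtain ⟨g, hg, hg'⟩ := exists_backward ψ
  obtain ⟨m, hm, hm'⟩ := exists_mul hC ψ
  refine ⟨g + f + m, fun n => ?_, ?_⟩
  · simp [schrodingerFun, hf, hg, hm]
  · have := norm_add₃_le (a := g) (b := f) (c := m)
    linarith

/-- For bounded `V`, the expression `schrodingerFun V` maps `ℓ²` to `ℓ²`. -/
theorem memℓp_schrodingerFun {V : ℕ+ → ℝ} (hV : ∃ C : ℝ, ∀ n, |V n| ≤ C) (ψ : L2) :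
    Memℓp (schrodingerFun V ψ) 2 := by
  obtain ⟨C, hC⟩ := hV
  obtain ⟨g, hg, -⟩ := exists_schrodinger hC ψ
  have : schrodingerFun V ψ = ⇑g := funext fun n => (hg n).symm
  rw [this]
  exact lp.memℓp g

/-- The half-line discrete Schrödinger operator `H` on `ℓ²(ℕ)` with Dirichlet boundary condition
and bounded potential `V`. -/
def schrodinger (V : ℕ+ → ℝ) (hV : ∃ C : ℝ, ∀ n, |V n| ≤ C) : L2 →L[ℂ] L2 :=
  LinearMap.mkContinuousOfExistsBound
    { toFun := fun ψ => ⟨schrodingerFun V ψ, memℓp_schrodingerFun hV ψ⟩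
      map_add' := fun ψ φ => by
        ext n
        change schrodingerFun V _ n = schrodingerFun V _ n + schrodingerFun V _ n
        rcases eq_or_ne n 1 with rfl | hn <;> simp [schrodingerFun, *] <;> ring
      map_smul' := fun c ψ => by
        ext n
        change schrodingerFun V _ n = c * schrodingerFun V _ n
        rcases eq_or_ne n 1 with rfl | hn <;> simp [schrodingerFun, *] <;> ring }
    (by
      obtain ⟨C, hC⟩ := hV
      refine ⟨2 + C, fun ψ => ?_⟩
      obtain ⟨g, hg, hg'⟩ := exists_schrodinger hC ψ
      refine le_of_eq_of_le (congrArg norm ?_) hg'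
      ext n
      exact (hg n).symm)

/-- The defining formula of `H`. -/
theorem schrodinger_apply (V : ℕ+ → ℝ) (hV : ∃ C : ℝ, ∀ n, |V n| ≤ C) (ψ : L2) (n : ℕ+) :
    schrodinger V hV ψ n =
      (if n = 1 then 0 else ψ (n - 1)) + ψ (n + 1) + (V n : ℂ) * ψ n := rfl

/-- The state `ψ(t) = exp(-itH) ψ` at time `t`. -/
def evolve (H : L2 →L[ℂ] L2) (ψ : L2) (t : ℝ) : L2 :=
  NormedSpace.exp ((-(Complex.I * (t : ℂ))) • H) ψ

/-- `a(n,T) = (1/T) ∫_0^∞ e^{-2t/T} |⟨δ_n, ψ(t)⟩|² dt`. -/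
def timeAvgProb (H : L2 →L[ℂ] L2) (ψ : L2) (n : ℕ+) (T : ℝ) : ℝ :=
  1 / T * ∫ t in Set.Ioi (0 : ℝ), Real.exp (-2 * t / T) * ‖inner ℂ (delta n) (evolve H ψ t)‖ ^ 2

/-- `⟨|X|_ψ^p⟩(T) = ∑_n |n|^p a(n,T)`, a sum of nonnegative terms taken in `[0,∞]`. -/
def moment (H : L2 →L[ℂ] L2) (ψ : L2) (p T : ℝ) : ℝ≥0∞ :=
  ∑' n : ℕ+, ENNReal.ofReal (((n : ℕ) : ℝ) ^ p * timeAvgProb H ψ n T)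

/-- The lower growth exponent
`β⁻_ψ(p) = liminf_{T → ∞} log ⟨|X|_ψ^p⟩(T) / log T`, in the extended reals. -/
def lowerGrowthExponent (H : L2 →L[ℂ] L2) (ψ : L2) (p : ℝ) : EReal :=
  Filter.liminf (fun T : ℝ => ENNReal.log (moment H ψ p T) / ((Real.log T : ℝ) : EReal))
    Filter.atTop

/-- (S1): for `n` large enough, if `V n = b` then `V (n-1) = V (n+1) = a`. -/
def EventuallyIsolated (V : ℕ+ → ℝ) (a b : ℝ) : Prop :=
  ∃ N : ℕ+, ∀ n : ℕ+, N ≤ n → 1 < n → V n = b → V (n - 1) = a ∧ V (n + 1) = a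

/-- (S2): for `n` large enough, every run of exactly `k ≥ 1` consecutive `a`'s that is enclosed
by a `b` at `n` and a `b` at `n+k+1` has odd length `k`. -/
def EventuallyOddRuns (V : ℕ+ → ℝ) (a b : ℝ) : Prop :=
  ∃ N : ℕ+, ∀ n : ℕ+, N ≤ n → ∀ k : ℕ+, V n = b → V (n + k + 1) = b →
    (∀ j : ℕ+, j ≤ k → V (n + j) = a) → Odd (k : ℕ)

end HalfLine

end

/-! Far out, the sites with V = b share one parity: by (S1) two of them are never adjacent, and by
(S2) consecutive ones lie an even distance apart (`exists_parity`). At z = a + 2i/T the sites of the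
other parity therefore have |z - V| = 2/T, so in g(k) + g(k+2) = (z - V(k+1)) g(k+1) every second
coefficient is O(1/T). Weighting the values at the b-parity by √T, each backward step costs only a
factor 1 + O(1/√T), so going back over O(√T) sites costs O(√T) in all (`norm_le_of_recurrence`).

The Laplace transform of the evolution at z is the Green function up to a phase. The source at δ₁
acts as a boundary value of modulus 1 at site 0, so the Green function is at least of order 1/√T on
each pair of adjacent sites between a fixed index and about 2√T (`exists_le_laplace`).
Cauchy–Schwarz in time (`le_timeAvgProb`) gives a(n,T) + a(n+1,T) ≳ T⁻³ from this single energy.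
Summing n^p over about √T sites with n of order √T yields T^((p+1)/2 - 3) = T^((p-5)/2). -/

/-- Beyond some index, all occurrences of `b` have the same parity. -/
theorem HalfLine.exists_parity {a b : ℝ} {V : ℕ+ → ℝ} (hV : ∀ n, V n = a ∨ V n = b)
    (hS1 : EventuallyIsolated V a b) (hS2 : EventuallyOddRuns V a b) :
    ∃ N q : ℕ, ∀ n : ℕ+, N ≤ n → V n ≠ a → (n : ℕ) % 2 = q % 2 := by
  obtain ⟨N₁, h₁⟩ := hS1
  obtain ⟨N₂, h₂⟩ := hS2
  have hab : a ≠ b := by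
    -- For a = b the potential is constant, and a "run" of length 2 contradicts (S2).
    rintro rfl
    have hc : ∀ n, V n = a := fun n => (hV n).elim id id
    exact absurd (h₂ N₂ le_rfl 2 (hc _) (hc _) fun _ _ => hc _) (by decide)
  have key : ∀ d : ℕ, ∀ m n : ℕ+, N₁ ≤ m → N₂ ≤ m → (n : ℕ) = m + d → V m = b → V n = b →
      (n : ℕ) % 2 = (m : ℕ) % 2 := by
    intro d
    induction d using Nat.strong_induction_on with
    | _ d ih =>
      intro m n hm₁ hm₂ hmn hm hn
      -- Split at an intermediate b if there is one; otherwise m and n enclose a run of d - 1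
      -- letters a.
      by_cases hex : ∃ l : ℕ+, m < l ∧ l < n ∧ V l = b
      · obtain ⟨l, hml, hln, hl⟩ := hex
        have h1 : (m : ℕ) < l := hml
        have h2 : (l : ℕ) < n := hln
        have e1 := ih (l - m) (by omega) m l hm₁ hm₂ (by omega) hm hl
        have e2 := ih (n - l) (by omega) l n (hm₁.trans hml.le) (hm₂.trans hml.le)
          (by omega) hl hn
        omega
      · push Not at hex
        rcases Nat.eq_zero_or_pos d with rfl | hd
        · omega
        rcases Nat.lt_or_ge 1 d with hd1 | hd1
        · set k : ℕ+ := ⟨d - 1, by omega⟩ with hk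
          have hkd : (k : ℕ) = d - 1 := rfl
          have hnk : n = m + k + 1 := by
            apply PNat.coe_injective
            simp only [PNat.add_coe, hkd, PNat.one_coe]
            omega
          have := h₂ m hm₂ k hm (hnk ▸ hn) fun j hj => by
            have hj' : (j : ℕ) ≤ k := hj
            refine (hV _).resolve_right (hex _ ?_ ?_)
            · exact PNat.lt_add_right _ _
            · rw [← PNat.coe_lt_coe, PNat.add_coe]
              omega
          rw [Nat.odd_iff] at this
          omega
        · have hnm : n = m + 1 := by
            apply PNat.coe_injective
            simp only [PNat.add_coe, PNat.one_coe]
            omega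
          have hlt : m < m + 1 := PNat.lt_add_right _ _
          have := (h₁ (m + 1) (hm₁.trans hlt.le) (one_le.trans_lt hlt) (hnm ▸ hn)).1
          have hs : m + 1 - 1 = m := by
            apply PNat.coe_injective
            rw [PNat.sub_coe]
            simp
          rw [hs] at this
          exact absurd (this.symm.trans hm) hab
  by_cases hex : ∃ m : ℕ+, N₁ ≤ m ∧ N₂ ≤ m ∧ V m = b
  · obtain ⟨m, hm₁, hm₂, hm⟩ := hex
    refine ⟨m, m, fun n hn hna => ?_⟩
    exact key (n - m) m n hm₁ hm₂ (by omega) hm ((hV n).resolve_left hna)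
  · push Not at hex
    -- No b occurs this far out, so the parity 0 is arbitrary.
    refine ⟨max N₁ N₂, 0, fun n hn hna => ?_⟩
    refine absurd ((hV n).resolve_left hna) (hex n ?_ ?_)
    · exact PNat.coe_le_coe _ _ |>.1 ((le_max_left _ _).trans hn)
    · exact PNat.coe_le_coe _ _ |>.1 ((le_max_right _ _).trans hn)

/-! ### Unitary evolution, its Laplace transform, and time averages -/

noncomputable section

open MeasureTheory Set Filter Topology

namespace HalfLine

theorem delta_apply (m n : ℕ+) : delta m n = if n = m then 1 else 0 := by
  simp [delta, Pi.single_apply]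

theorem inner_delta (n : ℕ+) (ψ : L2) : inner ℂ (delta n) ψ = ψ n := by
  simp [delta, lp.inner_single_left]

theorem schrodinger_delta (V : ℕ+ → ℝ) (hV : ∃ C : ℝ, ∀ n, |V n| ≤ C) (n : ℕ+) :
    schrodinger V hV (delta n) =
      delta (n + 1) + (if n = 1 then 0 else delta (n - 1)) + (V n : ℂ) • delta n := by
  ext k
  rw [schrodinger_apply]
  simp only [lp.coeFn_add, lp.coeFn_smul, Pi.add_apply, Pi.smul_apply, smul_eq_mul]
  have e1 : (if k = 1 then 0 else delta n (k - 1)) = delta (n + 1) k := by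
    rw [delta_apply, delta_apply]
    rcases eq_or_ne k 1 with rfl | hk
    · have : (1 : ℕ+) ≠ n + 1 := (PNat.lt_add_left 1 n).ne
      simp [this]
    · have h : k - 1 + 1 = k := PNat.sub_add_of_lt (lt_of_le_of_ne one_le hk.symm)
      have : k - 1 = n ↔ k = n + 1 :=
        ⟨fun h' => by rw [← h', h], fun h' => add_right_cancel (h.trans h')⟩
      simp [hk, this]
  have e2 : delta n (k + 1) = (if n = 1 then 0 else delta (n - 1) : L2) k := by
    rcases eq_or_ne n 1 with rfl | hn
    · have : k + 1 ≠ 1 := (PNat.lt_add_left 1 k).ne'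
      simp [delta_apply, this]
    · have h : n - 1 + 1 = n := PNat.sub_add_of_lt (lt_of_le_of_ne one_le hn.symm)
      have : k + 1 = n ↔ k = n - 1 :=
        ⟨fun h' => add_right_cancel (h'.trans h.symm), fun h' => by rw [h', h]⟩
      simp [hn, delta_apply, this]
  have e3 : (V k : ℂ) * delta n k = (V n : ℂ) * delta n k := by
    rw [delta_apply]
    split_ifs with h
    · rw [h]
    · simp
  rw [e1, e2, e3]

theorem isSelfAdjoint_schrodinger (V : ℕ+ → ℝ) (hV : ∃ C : ℝ, ∀ n, |V n| ≤ C) :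
    IsSelfAdjoint (schrodinger V hV) := by
  rw [ContinuousLinearMap.isSelfAdjoint_iff']
  ext ψ n
  rw [← inner_delta, ContinuousLinearMap.adjoint_inner_right, schrodinger_delta,
    schrodinger_apply, inner_add_left, inner_add_left, inner_smul_left, inner_delta, inner_delta]
  rcases eq_or_ne n 1 with rfl | hn
  · simp
  · simp [hn, inner_delta, add_comm]

theorem norm_evolve {H : L2 →L[ℂ] L2} (hH : IsSelfAdjoint H) (ψ : L2) (t : ℝ) :
    ‖evolve H ψ t‖ = ‖ψ‖ := by
  let _ := NormedAlgebra.restrictScalars ℚ ℂ (L2 →L[ℂ] L2)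
  refine ContinuousLinearMap.norm_map_of_mem_unitary ?_ ψ
  refine NormedSpace.exp_mem_unitary_of_mem_skewAdjoint (hH.smul_mem_skewAdjoint ?_)
  simp [skewAdjoint.mem_iff]

theorem hasDerivAt_evolve (H : L2 →L[ℂ] L2) (ψ : L2) (t : ℝ) :
    HasDerivAt (evolve H ψ) (-Complex.I • H (evolve H ψ t)) t := by
  have h1 := (hasDerivAt_exp_smul_const' (𝕂 := ℂ) (-Complex.I • H) (t : ℂ)).scomp t
    (Complex.ofRealCLM.hasDerivAt (x := t))
  have h2 := ((ContinuousLinearMap.apply ℂ L2 ψ).restrictScalars ℝ).hasFDerivAt.comp_hasDerivAt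
    t h1
  have e : ∀ s : ℝ, (s : ℂ) • (-Complex.I • H) = (-(Complex.I * (s : ℂ))) • H := fun s => by
    rw [smul_smul]
    congr 1
    ring
  simp only [Function.comp_def, Complex.ofRealCLM_apply, e] at h2
  have e' : evolve H ψ = fun s : ℝ => NormedSpace.exp ((-(Complex.I * (s : ℂ))) • H) ψ := rfl
  simpa [e'] using h2

theorem continuous_evolve (H : L2 →L[ℂ] L2) (ψ : L2) : Continuous (evolve H ψ) :=
  continuous_iff_continuousAt.2 fun t => (hasDerivAt_evolve H ψ t).continuousAt

theorem evolve_zero (H : L2 →L[ℂ] L2) (ψ : L2) : evolve H ψ 0 = ψ := by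
  simp [evolve]

theorem norm_exp_I_mul (z : ℂ) (t : ℝ) : ‖Complex.exp (Complex.I * z * t)‖ =
    Real.exp (-z.im * t) := by
  rw [Complex.norm_exp]
  simp

theorem integrableOn_laplace {H : L2 →L[ℂ] L2} (hH : IsSelfAdjoint H) (ψ : L2) {z : ℂ}
    (hz : 0 < z.im) :
    IntegrableOn (fun t : ℝ => Complex.exp (Complex.I * z * t) • evolve H ψ t) (Ioi 0) := by
  have h := (exp_neg_integrableOn_Ioi 0 hz).mul_const ‖ψ‖
  refine h.mono' ?_ (Eventually.of_forall fun t => ?_)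
  · have h1 : Continuous fun t : ℝ => Complex.exp (Complex.I * z * t) := by fun_prop
    exact (h1.smul (continuous_evolve H ψ)).aestronglyMeasurable
  · rw [norm_smul, norm_evolve hH, norm_exp_I_mul]

/-- `∫_0^∞ e^{izt} ψ(t) dt`. -/
def laplace (H : L2 →L[ℂ] L2) (ψ : L2) (z : ℂ) : L2 :=
  ∫ t in Ioi (0 : ℝ), Complex.exp (Complex.I * z * t) • evolve H ψ t

/-- Integrate the derivative of e^{izt}ψ(t) over the half-line: unitarity and Im z > 0 kill the term
at infinity. Thus `laplace` is -i(H - z)⁻¹ψ. -/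
theorem apply_laplace {H : L2 →L[ℂ] L2} (hH : IsSelfAdjoint H) (ψ : L2) {z : ℂ}
    (hz : 0 < z.im) : H (laplace H ψ z) = z • laplace H ψ z - Complex.I • ψ := by
  have hint := integrableOn_laplace hH ψ hz
  have hd : ∀ t ∈ Ici (0 : ℝ),
      HasDerivAt (fun t : ℝ => Complex.exp (Complex.I * z * t) • evolve H ψ t)
      ((Complex.I • (z • ContinuousLinearMap.id ℂ L2 - H))
        (Complex.exp (Complex.I * z * t) • evolve H ψ t)) t := by
    intro t _
    have h1 : HasDerivAt (fun t : ℝ => Complex.exp (Complex.I * z * t))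
        (Complex.exp (Complex.I * z * t) * (Complex.I * z)) t := by
      have := ((hasDerivAt_id (t : ℂ)).const_mul (Complex.I * z)).cexp.comp_ofReal
      simpa using this
    have h2 := h1.smul (hasDerivAt_evolve H ψ t)
    refine h2.congr_deriv ?_
    rw [smul_apply, sub_apply, smul_apply, ContinuousLinearMap.id_apply, map_smul]
    module
  have hlim : Tendsto (fun t : ℝ => Complex.exp (Complex.I * z * t) • evolve H ψ t) atTop
      (𝓝 0) := by
    rw [tendsto_zero_iff_norm_tendsto_zero]
    simp only [norm_smul, norm_evolve hH, norm_exp_I_mul]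
    have : Tendsto (fun t : ℝ => Real.exp (-z.im * t)) atTop (𝓝 0) :=
      Real.tendsto_exp_atBot.comp (tendsto_id.const_mul_atTop_of_neg (neg_neg_iff_pos.2 hz))
    simpa using this.mul_const ‖ψ‖
  have h := integral_Ioi_of_hasDerivAt_of_tendsto' hd
    (ContinuousLinearMap.integrable_comp _ hint) hlim
  rw [ContinuousLinearMap.integral_comp_comm _ hint] at h
  simp only [evolve_zero, Complex.ofReal_zero, mul_zero, Complex.exp_zero, one_smul,
    zero_sub] at h
  change (Complex.I • (z • ContinuousLinearMap.id ℂ L2 - H)) (laplace H ψ z) = -ψ at h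
  simp only [smul_apply, sub_apply,
    ContinuousLinearMap.id_apply] at h
  have h' := congrArg (Complex.I • ·) h
  simp only [smul_smul, Complex.I_mul_I, smul_neg, neg_smul, one_smul] at h'
  rw [neg_sub] at h'
  rw [sub_eq_iff_eq_add'.1 h', sub_eq_add_neg]

/-- The variance of f under the probability measure ε e^{-εt} dt is nonnegative; s below is the
mean. -/
theorem mul_sq_integral_exp_mul_le {f : ℝ → ℝ} {ε : ℝ} (hε : 0 < ε)
    (hi1 : IntegrableOn (fun t : ℝ => Real.exp (-ε * t) * f t) (Ioi 0))
    (hi2 : IntegrableOn (fun t : ℝ => Real.exp (-ε * t) * f t ^ 2) (Ioi 0)) :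
    ε * (∫ t in Ioi (0 : ℝ), Real.exp (-ε * t) * f t) ^ 2 ≤
      ∫ t in Ioi (0 : ℝ), Real.exp (-ε * t) * f t ^ 2 := by
  have hexp := exp_neg_integrableOn_Ioi 0 hε
  set X := ∫ t in Ioi (0 : ℝ), Real.exp (-ε * t) * f t with hX
  set Y := ∫ t in Ioi (0 : ℝ), Real.exp (-ε * t) * f t ^ 2 with hY
  have hE : ∫ t in Ioi (0 : ℝ), Real.exp (-ε * t) = 1 / ε := by
    rw [integral_exp_mul_Ioi (by linarith)]
    simp [neg_div_neg_eq]
  set s := ε * X with hs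
  have h0 : 0 ≤ ∫ t in Ioi (0 : ℝ), Real.exp (-ε * t) * (f t - s) ^ 2 :=
    integral_nonneg fun t => by positivity
  have e : ∫ t in Ioi (0 : ℝ), Real.exp (-ε * t) * (f t - s) ^ 2 =
      Y - 2 * s * X + s ^ 2 * (1 / ε) := by
    have e1 := integral_sub hi2 (hi1.const_mul (2 * s))
    have e2 := integral_add (hi2.sub (hi1.const_mul (2 * s))) (hexp.const_mul (s ^ 2))
    simp only [Pi.sub_apply, e1, integral_const_mul, hE] at e2
    rw [hX, hY, ← e2]
    refine integral_congr_ae (Eventually.of_forall fun t => ?_)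
    simp only
    ring
  rw [e, hs] at h0
  have : (ε * X) ^ 2 * (1 / ε) = ε * X ^ 2 := by field_simp
  nlinarith

/-- A Cauchy–Schwarz lower bound of the time-averaged probability by the resolvent. -/
theorem le_timeAvgProb {H : L2 →L[ℂ] L2} (hH : IsSelfAdjoint H) (ψ : L2) (n : ℕ+) {T : ℝ}
    (hT : 0 < T) {z : ℂ} (hz : z.im = 2 / T) :
    2 / T ^ 2 * ‖laplace H ψ z n‖ ^ 2 ≤ timeAvgProb H ψ n T := by
  have hε : 0 < z.im := by rw [hz]; positivity
  have hcont : Continuous fun t => evolve H ψ t n := by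
    have : (fun t => evolve H ψ t n) = fun t => inner ℂ (delta n) (evolve H ψ t) := by
      funext t; rw [inner_delta]
    rw [this]
    exact continuous_const.inner (continuous_evolve H ψ)
  have hbd : ∀ t, ‖evolve H ψ t n‖ ≤ ‖ψ‖ := fun t =>
    (lp.norm_apply_le_norm (by norm_num) _ n).trans (norm_evolve hH ψ t).le
  have hexp := exp_neg_integrableOn_Ioi 0 hε
  have hi1 : IntegrableOn (fun t : ℝ => Real.exp (-z.im * t) * ‖evolve H ψ t n‖) (Ioi 0) := by
    refine (hexp.mul_const ‖ψ‖).mono' ?_ (Eventually.of_forall fun t => ?_)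
    · exact Continuous.aestronglyMeasurable (by fun_prop)
    · rw [norm_mul, norm_norm, Real.norm_eq_abs, Real.abs_exp]
      gcongr
      exact hbd t
  have hi2 : IntegrableOn (fun t : ℝ => Real.exp (-z.im * t) * ‖evolve H ψ t n‖ ^ 2)
      (Ioi 0) := by
    refine (hexp.mul_const (‖ψ‖ ^ 2)).mono' ?_ (Eventually.of_forall fun t => ?_)
    · exact Continuous.aestronglyMeasurable (by fun_prop)
    · rw [norm_mul, norm_pow, norm_norm, Real.norm_eq_abs, Real.abs_exp]
      gcongr
      exact hbd t
  set X := ∫ t in Ioi (0 : ℝ), Real.exp (-z.im * t) * ‖evolve H ψ t n‖ with hX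
  set Y := ∫ t in Ioi (0 : ℝ), Real.exp (-z.im * t) * ‖evolve H ψ t n‖ ^ 2 with hY
  have hGX : ‖laplace H ψ z n‖ ≤ X := by
    have : laplace H ψ z n =
        ∫ t in Ioi (0 : ℝ), Complex.exp (Complex.I * z * t) * evolve H ψ t n := by
      have := (innerSL ℂ (delta n)).integral_comp_comm (integrableOn_laplace hH ψ hε)
      simp only [innerSL_apply_apply, inner_smul_right, inner_delta] at this
      exact this.symm
    rw [this]
    refine (norm_integral_le_integral_norm _).trans_eq ?_
    simp only [norm_mul, norm_exp_I_mul, hX]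
  have hXY : z.im * X ^ 2 ≤ Y := mul_sq_integral_exp_mul_le hε hi1 hi2
  have hY' : timeAvgProb H ψ n T = 1 / T * Y := by
    simp only [timeAvgProb, inner_delta, hY, hz]
    congr 1
    refine integral_congr_ae (Eventually.of_forall fun t => ?_)
    simp only
    congr 2
    ring
  calc 2 / T ^ 2 * ‖laplace H ψ z n‖ ^ 2 ≤ 2 / T ^ 2 * X ^ 2 := by gcongr
    _ = 1 / T * (z.im * X ^ 2) := by rw [hz]; field_simp
    _ ≤ 1 / T * Y := by gcongr
    _ = _ := hY'.symm

end HalfLine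

end

/-! ### Weighted bound for the recurrence -/

/-- Backward growth bound for solutions of a three-term recurrence whose coefficients are
`O(L⁻²)` at all indices of one parity: over `O(L)` steps solutions grow at most by `O(L)`. -/
theorem norm_le_of_recurrence {g w : ℕ → ℂ} {C L : ℝ} {N q : ℕ} (hC : 0 ≤ C) (hL : 1 ≤ L)
    (hrec : ∀ k, g k + g (k + 2) = w (k + 1) * g (k + 1)) (hw : ∀ k, ‖w (k + 1)‖ ≤ C)
    (hw' : ∀ k, N ≤ k + 1 → (k + 1) % 2 ≠ q % 2 → ‖w (k + 1)‖ ≤ C / L ^ 2) (d : ℕ) :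
    ‖g 0‖ ≤ (1 + C) ^ N * (1 + C / L) ^ d * (L * (‖g (N + d)‖ + ‖g (N + d + 1)‖)) := by
  have hg : ∀ k, ‖g k‖ ≤ ‖g (k + 2)‖ + ‖w (k + 1)‖ * ‖g (k + 1)‖ := fun k => by
    have h := norm_sub_le (w (k + 1) * g (k + 1)) (g (k + 2))
    rw [← eq_sub_of_add_eq (hrec k), norm_mul] at h
    linarith
  -- Below N parity gives no information, so each step costs the crude factor 1 + C.
  have hbelow : ∀ k, ‖g 0‖ + ‖g 1‖ ≤ (1 + C) ^ k * (‖g k‖ + ‖g (k + 1)‖) := by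
    intro k
    induction k with
    | zero => simp
    | succ k ih =>
      refine ih.trans ?_
      rw [pow_succ, mul_assoc]
      gcongr
      have h1 := hg k
      have h2 := mul_le_mul_of_nonneg_right (hw k) (norm_nonneg (g (k + 1)))
      have h3 := mul_nonneg hC (norm_nonneg (g (k + 2)))
      change _ ≤ (1 + C) * (‖g (k + 1)‖ + ‖g (k + 2)‖)
      linarith
  -- The weight L sits on the index of parity q. A coefficient of size C then multiplies a value
  -- already weighted by L, while a coefficient C/L² enters multiplied by L; both contribute at
  -- relative size C/L.
  set P : ℕ → ℝ := fun k =>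
    if k % 2 = q % 2 then L * ‖g k‖ + ‖g (k + 1)‖ else ‖g k‖ + L * ‖g (k + 1)‖ with hP
  have hL0 : 0 < L := by linarith
  have hstep : ∀ k, N ≤ k → P k ≤ (1 + C / L) * P (k + 1) := by
    intro k hk
    have h1 := hg k
    have hCL : 0 ≤ C / L := by positivity
    by_cases hq : (k + 1) % 2 = q % 2
    · have hq' : k % 2 ≠ q % 2 := by omega
      simp only [hP, hq, hq', if_true, if_false, add_assoc, Nat.reduceAdd]
      have h2 := mul_le_mul_of_nonneg_right (hw k) (norm_nonneg (g (k + 1)))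
      have h3 := mul_nonneg hCL (norm_nonneg (g (k + 2)))
      have h4 : C / L * (L * ‖g (k + 1)‖) = C * ‖g (k + 1)‖ := by field_simp
      linarith
    · have hq' : k % 2 = q % 2 := by omega
      simp only [hP, hq, hq', if_true, if_false, add_assoc, Nat.reduceAdd]
      have h2 := mul_le_mul_of_nonneg_right (hw' k (by omega) hq) (norm_nonneg (g (k + 1)))
      have h3 := mul_nonneg hCL (mul_nonneg hL0.le (norm_nonneg (g (k + 2))))
      have h4 : L * (C / L ^ 2 * ‖g (k + 1)‖) = C / L * ‖g (k + 1)‖ := by field_simp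
      have h5 := mul_le_mul_of_nonneg_left (h1.trans (add_le_add_right h2 _)) hL0.le
      rw [mul_add, h4] at h5
      linarith
  have habove : ∀ d, P N ≤ (1 + C / L) ^ d * P (N + d) := by
    intro d
    induction d with
    | zero => simp
    | succ d ih =>
      refine ih.trans ?_
      rw [pow_succ, mul_assoc]
      gcongr
      exact hstep _ (by omega)
  have hlow : ‖g N‖ + ‖g (N + 1)‖ ≤ P N := by
    have h1 := mul_le_mul_of_nonneg_right hL (norm_nonneg (g N))
    have h2 := mul_le_mul_of_nonneg_right hL (norm_nonneg (g (N + 1)))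
    simp only [hP]
    split_ifs <;> linarith
  have hhigh : ∀ n, P n ≤ L * (‖g n‖ + ‖g (n + 1)‖) := by
    intro n
    have h1 := mul_le_mul_of_nonneg_right hL (norm_nonneg (g n))
    have h2 := mul_le_mul_of_nonneg_right hL (norm_nonneg (g (n + 1)))
    simp only [hP]
    split_ifs <;> linarith
  calc ‖g 0‖ ≤ ‖g 0‖ + ‖g 1‖ := le_add_of_nonneg_right (norm_nonneg _)
    _ ≤ (1 + C) ^ N * (‖g N‖ + ‖g (N + 1)‖) := hbelow N
    _ ≤ (1 + C) ^ N * ((1 + C / L) ^ d * (L * (‖g (N + d)‖ + ‖g (N + d + 1)‖))) := by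
      gcongr
      refine (hlow.trans (habove d)).trans ?_
      gcongr
      exact hhigh _
    _ = _ := by ring

/-! ### Green function at energy a, moments, and growth exponent -/

noncomputable section

open Filter Topology

namespace HalfLine

theorem schrodinger_apply_succPNat (V : ℕ+ → ℝ) (hV : ∃ C : ℝ, ∀ n, |V n| ≤ C) (ψ : L2)
    (k : ℕ) : schrodinger V hV ψ k.succPNat =
      (if k = 0 then 0 else ψ k.toPNat') + ψ (k + 1).succPNat + V k.succPNat * ψ k.succPNat := by
  rw [schrodinger_apply]
  have h2 : k.succPNat + 1 = (k + 1).succPNat := rfl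
  rw [h2]
  rcases k with _ | k
  · simp [show Nat.succPNat 0 = 1 from rfl]
  · have h1 : (k + 1).succPNat ≠ 1 := by
      rw [Ne, ← PNat.coe_inj]
      simp
    have h3 : (k + 1).succPNat - 1 = (k + 1).toPNat' := by
      apply PNat.coe_injective
      rw [PNat.sub_coe, if_pos (lt_of_le_of_ne one_le h1.symm)]
      simp
    simp [h1, h3]

/-- At the energy `a` the Green function decays at most like `1 / √T` over distances `O(√T)`,
at distance `1 / T` from the real axis. -/
theorem exists_le_laplace {a b : ℝ} {V : ℕ+ → ℝ} (hV : ∀ n, V n = a ∨ V n = b)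
    (hS1 : EventuallyIsolated V a b) (hS2 : EventuallyOddRuns V a b) :
    ∃ (N : ℕ) (K : ℝ), 0 < K ∧ ∀ T : ℝ, 1 ≤ T → ∀ n : ℕ, N ≤ n → (n + 1 : ℝ) ≤ 2 * √T →
      1 ≤ K * √T *
        (‖laplace (schrodinger V (bounded_of_two_values hV)) (delta 1)
            (a + (2 / T : ℝ) * Complex.I) n.succPNat‖ +
          ‖laplace (schrodinger V (bounded_of_two_values hV)) (delta 1)
            (a + (2 / T : ℝ) * Complex.I) (n + 1).succPNat‖) := by
  obtain ⟨N, q, hq⟩ := exists_parity hV hS1 hS2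
  -- For T ≥ 1 this dominates |a - b| + 2/T, and C/T dominates 2/T.
  set C : ℝ := |a - b| + 2 with hCdef
  have hC : 0 ≤ C := by positivity
  refine ⟨N, (1 + C) ^ N * Real.exp (2 * C), by positivity, fun T hT n hn hnT => ?_⟩
  set H := schrodinger V (bounded_of_two_values hV) with hH
  set z : ℂ := a + (2 / T : ℝ) * Complex.I with hz
  set G := laplace H (delta 1) z with hG
  have hT0 : 0 < T := by linarith
  have hzim : z.im = 2 / T := by simp [hz]
  have hL : 1 ≤ √T := by rwa [Real.one_le_sqrt]
  have hL0 : 0 < √T := by linarith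
  have hLT : √T ^ 2 = T := Real.sq_sqrt hT0.le
  -- The value i at index 0 absorbs the source -iδ₁, making the recurrence homogeneous from k = 0
  -- on.
  set g : ℕ → ℂ := fun k => if k = 0 then Complex.I else G k.toPNat' with hg
  have hg1 : ∀ k : ℕ, g (k + 1) = G k.succPNat := fun k => by
    simp only [hg, Nat.add_eq_zero_iff, one_ne_zero, and_false, if_false]
    rfl
  set w : ℕ → ℂ := fun k => z - V k.toPNat' with hw
  have hw1 : ∀ k : ℕ, w (k + 1) = z - V k.succPNat := fun k => rfl
  have hrec : ∀ k, g k + g (k + 2) = w (k + 1) * g (k + 1) := by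
    intro k
    have h := congrArg (fun ψ : L2 => ψ k.succPNat)
      (apply_laplace (isSelfAdjoint_schrodinger V (bounded_of_two_values hV)) (delta 1)
        (z := z) (by rw [hzim]; positivity))
    simp only [schrodinger_apply_succPNat, lp.coeFn_sub, lp.coeFn_smul, Pi.sub_apply,
      Pi.smul_apply, smul_eq_mul, delta_apply] at h
    change _ + G _ + _ * G _ = z * G _ - _ at h
    rw [show k + 2 = (k + 1) + 1 from rfl, hg1, hg1, hw1]
    rcases k with _ | k
    · simp only [if_true] at h
      have h1 : (0 : ℕ).succPNat = 1 := rfl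
      rw [h1] at h ⊢
      simp only [hg, if_true] at h ⊢
      linear_combination h
    · have h1 : (k + 1).succPNat ≠ 1 := by
        rw [Ne, ← PNat.coe_inj]
        simp
      simp only [h1, if_false, Nat.add_eq_zero_iff, one_ne_zero, and_false] at h
      change G (k + 1).toPNat' + _ + _ = _ at h
      simp only [hg, Nat.add_eq_zero_iff, one_ne_zero, and_false, if_false]
      linear_combination h
  have hnorm : ‖((2 / T : ℝ) : ℂ) * Complex.I‖ = 2 / T := by
    rw [norm_mul, Complex.norm_I, mul_one, Complex.norm_real, Real.norm_of_nonneg (by positivity)]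
  have hwa : ∀ k : ℕ, V k.succPNat = a → ‖w (k + 1)‖ = 2 / T := fun k hk => by
    rw [hw1, hk, hz, add_sub_cancel_left, hnorm]
  have hT2 : 2 / T ≤ 2 := div_le_self (by norm_num) hT
  have hwC : ∀ k, ‖w (k + 1)‖ ≤ C := by
    intro k
    rcases hV k.succPNat with h | h
    · rw [hwa k h]
      have := abs_nonneg (a - b)
      linarith
    · rw [hw1, h, hz, add_sub_right_comm, ← Complex.ofReal_sub]
      refine (norm_add_le _ _).trans ?_
      rw [hnorm, Complex.norm_real, Real.norm_eq_abs]
      linarith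
  have hwC' : ∀ k, N ≤ k + 1 → (k + 1) % 2 ≠ q % 2 → ‖w (k + 1)‖ ≤ C / √T ^ 2 := by
    intro k hk hkq
    have h : V k.succPNat = a := by
      by_contra hne
      exact hkq (hq k.succPNat hk hne)
    rw [hwa k h, hLT]
    gcongr
    have := abs_nonneg (a - b)
    linarith
  have key := norm_le_of_recurrence hC hL hrec hwC hwC' (n + 1 - N)
  rw [Nat.add_sub_cancel' (by omega : N ≤ n + 1), hg1, hg1] at key
  have hg0 : ‖g 0‖ = 1 := by simp [hg]
  rw [hg0] at key
  refine key.trans ?_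
  rw [mul_assoc _ √T]
  gcongr
  have h1 : 1 + C / √T ≤ Real.exp (C / √T) := by
    rw [add_comm]
    exact Real.add_one_le_exp _
  calc (1 + C / √T) ^ (n + 1 - N) ≤ Real.exp (C / √T) ^ (n + 1 - N) := by gcongr
    _ = Real.exp ((n + 1 - N : ℕ) * (C / √T)) := (Real.exp_nat_mul _ _).symm
    _ ≤ Real.exp (2 * √T * (C / √T)) := by
      gcongr
      refine le_trans ?_ hnT
      have : n + 1 - N ≤ n + 1 := Nat.sub_le _ _
      exact_mod_cast this
    _ = Real.exp (2 * C) := by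
      congr 1
      field_simp

theorem exists_le_moment {a b : ℝ} {V : ℕ+ → ℝ} (hV : ∀ n, V n = a ∨ V n = b)
    (hS1 : EventuallyIsolated V a b) (hS2 : EventuallyOddRuns V a b) {p : ℝ} (hp : 0 < p) :
    ∃ c : ℝ, 0 < c ∧ ∀ᶠ T : ℝ in atTop, ENNReal.ofReal (c * T ^ ((p - 5) / 2)) ≤
      moment (schrodinger V (bounded_of_two_values hV)) (delta 1) p T := by
  obtain ⟨N, K, hK, hlow⟩ := exists_le_laplace hV hS1 hS2
  set H := schrodinger V (bounded_of_two_values hV) with hH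
  have hsa : IsSelfAdjoint H := isSelfAdjoint_schrodinger V _
  refine ⟨(1 / 2) ^ (p + 1) / (2 * K ^ 2), by positivity, ?_⟩
  -- This makes √T ≥ N + 2, so that m = ⌊√T⌋ satisfies both m ≥ N and m ≥ √T/2.
  filter_upwards [eventually_ge_atTop (((N : ℝ) + 2) ^ 2)] with T hT
  have hN0 : (0 : ℝ) ≤ N := Nat.cast_nonneg N
  have hT1 : 1 ≤ T := by nlinarith
  have hT0 : 0 < T := by linarith
  have hLN : (N : ℝ) + 2 ≤ √T := Real.le_sqrt_of_sq_le hT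
  have hL0 : 0 < √T := by linarith
  have hLT : √T ^ 2 = T := Real.sq_sqrt hT0.le
  set m : ℕ := ⌊√T⌋₊ with hm
  have hmL : (m : ℝ) ≤ √T := Nat.floor_le hL0.le
  have hmN : N ≤ m := Nat.le_floor (by linarith)
  have hLm : √T / 2 ≤ m := by
    have := Nat.lt_floor_add_one √T
    linarith
  set A : ℕ → ℝ := fun n => timeAvgProb H (delta 1) n.succPNat T with hA
  set B : ℝ := 1 / (K ^ 2 * T ^ 3) with hB
  have hB0 : 0 ≤ B := by positivity
  have hpair : ∀ i < m, B ≤ A (m + i) + A (m + i + 1) := by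
    intro i hi
    have h1 := hlow T hT1 (m + i) (by omega) (by
      have : m + i + 1 ≤ 2 * m := by omega
      have : ((m + i + 1 : ℕ) : ℝ) ≤ (2 * m : ℕ) := Nat.cast_le.2 this
      push_cast at this ⊢
      linarith)
    have hzim : ((a : ℂ) + (2 / T : ℝ) * Complex.I).im = 2 / T := by simp
    have h2 := le_timeAvgProb hsa (delta 1) (m + i).succPNat hT0 hzim
    have h3 := le_timeAvgProb hsa (delta 1) (m + i + 1).succPNat hT0 hzim
    set x := ‖laplace H (delta 1) ((a : ℂ) + (2 / T : ℝ) * Complex.I) (m + i).succPNat‖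
    set y := ‖laplace H (delta 1) ((a : ℂ) + (2 / T : ℝ) * Complex.I) (m + i + 1).succPNat‖
    have h4 : 1 ≤ 2 * (K ^ 2 * T) * (x ^ 2 + y ^ 2) := by
      have e1 : 1 ≤ (K * √T * (x + y)) ^ 2 := one_le_pow₀ h1
      have e2 : (K * √T * (x + y)) ^ 2 = K ^ 2 * T * (x + y) ^ 2 := by
        rw [mul_pow, mul_pow, hLT]
      have e3 : (x + y) ^ 2 ≤ 2 * (x ^ 2 + y ^ 2) := by nlinarith [sq_nonneg (x - y)]
      have e4 := mul_le_mul_of_nonneg_left e3 (by positivity : 0 ≤ K ^ 2 * T)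
      linarith
    calc B = 1 / (K ^ 2 * T ^ 3) * 1 := by rw [hB, mul_one]
      _ ≤ 1 / (K ^ 2 * T ^ 3) * (2 * (K ^ 2 * T) * (x ^ 2 + y ^ 2)) := by gcongr
      _ = 2 / T ^ 2 * x ^ 2 + 2 / T ^ 2 * y ^ 2 := by field_simp
      _ ≤ _ := add_le_add h2 h3
  have hA0 : ∀ n, 0 ≤ A n := fun n => by
    simp only [hA, timeAvgProb]
    exact mul_nonneg (by positivity) (MeasureTheory.integral_nonneg fun t => by positivity)
  set F : ℕ+ → ENNReal := fun n =>
    ENNReal.ofReal (((n : ℕ) : ℝ) ^ p * timeAvgProb H (delta 1) n T) with hF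
  have hFA : ∀ n, m ≤ n → ENNReal.ofReal ((m : ℝ) ^ p * A n) ≤ F n.succPNat := fun n hn => by
    refine ENNReal.ofReal_le_ofReal (mul_le_mul_of_nonneg_right ?_ (hA0 n))
    refine Real.rpow_le_rpow (Nat.cast_nonneg _) ?_ hp.le
    rw [Nat.succPNat_coe]
    exact_mod_cast hn.trans (Nat.le_succ n)
  have hsum : ∀ j : ℕ, ∑ i ∈ Finset.range m, F (m + i + j).succPNat ≤ moment H (delta 1) p T := by
    intro j
    refine (ENNReal.sum_le_tsum _).trans
      (ENNReal.tsum_comp_le_tsum_of_injective (f := fun i : ℕ => (m + i + j).succPNat) ?_ F)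
    intro i i' h
    have := Nat.succPNat_injective h
    omega
  -- Adjacent pairs overlap, so each site is counted at most twice; hence the factor 2.
  have htwo : ENNReal.ofReal (m * ((m : ℝ) ^ p * B)) ≤ 2 * moment H (delta 1) p T := by
    calc ENNReal.ofReal (m * ((m : ℝ) ^ p * B))
        = ∑ i ∈ Finset.range m, ENNReal.ofReal ((m : ℝ) ^ p * B) := by
          rw [Finset.sum_const, Finset.card_range, nsmul_eq_mul,
            ENNReal.ofReal_mul (Nat.cast_nonneg m), ENNReal.ofReal_natCast]
      _ ≤ ∑ i ∈ Finset.range m, (F (m + i + 0).succPNat + F (m + i + 1).succPNat) := by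
          refine Finset.sum_le_sum fun i hi => ?_
          refine le_trans ?_ (add_le_add (hFA _ (by omega)) (hFA _ (by omega)))
          have hmp : 0 ≤ (m : ℝ) ^ p := by positivity
          rw [← ENNReal.ofReal_add (mul_nonneg hmp (hA0 _)) (mul_nonneg hmp (hA0 _)), ← mul_add]
          exact ENNReal.ofReal_le_ofReal
            (mul_le_mul_of_nonneg_left (hpair i (Finset.mem_range.1 hi)) hmp)
      _ ≤ 2 * moment H (delta 1) p T := by
          rw [Finset.sum_add_distrib, two_mul]
          exact add_le_add (hsum 0) (hsum 1)
  have hreal : 2 * ((1 / 2) ^ (p + 1) / (2 * K ^ 2) * T ^ ((p - 5) / 2)) ≤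
      m * ((m : ℝ) ^ p * B) := by
    have hm0 : 0 < (m : ℝ) := by linarith
    have e1 : m * ((m : ℝ) ^ p * B) = (m : ℝ) ^ (p + 1) * B := by
      rw [Real.rpow_add_one hm0.ne']
      ring
    have e2 : (√T / 2) ^ (p + 1) ≤ (m : ℝ) ^ (p + 1) :=
      Real.rpow_le_rpow (by positivity) hLm (by linarith)
    have e3 : (√T / 2) ^ (p + 1) = (1 / 2) ^ (p + 1) * T ^ ((p + 1) / 2) := by
      rw [div_eq_mul_one_div, Real.mul_rpow hL0.le (by norm_num), Real.sqrt_eq_rpow,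
        ← Real.rpow_mul hT0.le, mul_comm]
      congr 2
      ring
    -- The T³ cancels the one in B, leaving the exponent (p+1)/2 - 3.
    have e4 : T ^ ((p + 1) / 2) = T ^ ((p - 5) / 2) * T ^ 3 := by
      rw [← Real.rpow_natCast, ← Real.rpow_add hT0]
      congr 1
      push_cast
      ring
    rw [e1]
    refine le_trans (le_of_eq ?_) (mul_le_mul_of_nonneg_right e2 hB0)
    rw [e3, e4, hB]
    field_simp
  have h2 := (ENNReal.ofReal_le_ofReal hreal).trans htwo
  rw [ENNReal.ofReal_mul (by norm_num), ENNReal.ofReal_ofNat] at h2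
  exact (ENNReal.mul_le_mul_iff_right (by norm_num) (by norm_num)).1 h2

theorem le_lowerGrowthExponent {H : L2 →L[ℂ] L2} {ψ : L2} {p c s : ℝ} (hc : 0 < c)
    (h : ∀ᶠ T : ℝ in atTop, ENNReal.ofReal (c * T ^ s) ≤ moment H ψ p T) :
    (s : EReal) ≤ lowerGrowthExponent H ψ p := by
  have hlim : Tendsto (fun T : ℝ => ((Real.log c / Real.log T + s : ℝ) : EReal)) atTop
      (𝓝 (s : EReal)) := by
    refine (continuous_coe_real_ereal.tendsto s).comp ?_
    have := (Real.tendsto_log_atTop.const_div_atTop (Real.log c)).add_const s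
    simpa using this
  rw [← hlim.liminf_eq]
  refine liminf_le_liminf ?_
  filter_upwards [h, eventually_gt_atTop 1] with T hT hT1
  have hlog : 0 < Real.log T := Real.log_pos hT1
  have hT0 : 0 < T := by linarith
  have hval : Real.log c / Real.log T + s = Real.log (c * T ^ s) / Real.log T := by
    rw [Real.log_mul hc.ne' (by positivity), Real.log_rpow hT0]
    field_simp
  rw [hval, EReal.coe_div, ← ENNReal.log_ofReal_of_pos (by positivity)]
  exact EReal.div_le_div_right_of_nonneg (EReal.coe_nonneg.2 hlog.le) (ENNReal.log_le_log hT)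

end HalfLine

end

theorem theorem4p1 (a b : ℝ) (V : ℕ+ → ℝ) (hV : ∀ n, V n = a ∨ V n = b)
    (hS1 : HalfLine.EventuallyIsolated V a b) (hS2 : HalfLine.EventuallyOddRuns V a b)
    (p : ℝ) (hp : 0 < p) :
    (((p - 5) / 2 : ℝ) : EReal) ≤
      HalfLine.lowerGrowthExponent
        (HalfLine.schrodinger V (HalfLine.bounded_of_two_values hV)) (HalfLine.delta 1) p := by
  obtain ⟨c, hc, h⟩ := HalfLine.exists_le_moment hV hS1 hS2 hp
  exact HalfLine.le_lowerGrowthExponent hc h
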